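/- Let $N$ be a natural number. Let $\mathcal X$ (state space) and $\mathcal Y^1,\dots,\mathcal Y^N$ (observation spaces) be $\sigma$-compact complete separable metric spaces, and let $\mathcal U^1,\dots,\mathcal U^N$ (action spaces) be non-empty compact subsets of Polish spaces, all with their Borel $\sigma$-algebras. Let $c:\mathcal X\times\prod_i\mathcal Y^i\times\prod_i\mathcal U^i\to[0,\infty)$ be continuous and bounded, and let $P$ be a Borel probability measure on $\mathcal X\times\prod_i\mathcal Y^i$, the joint law of the state $X$ and the observations $Y^1,\dots,Y^N$. Condition C1. Let $(A,d)$ be a metric space, $Y$ a topological space and $\nu$ a (non-negative) Borel measure on $Y$. A pair $(\eta,\nu)$ with $\eta:A\times Y\to\mathbb R$ satisfies Condition C1 if $\eta$ is continuous and there is a bounded measurable function $h:A\times Y\to[0,\infty)$ with $\sup_{a\in A}\int_Y h(a,y)\,\nu(dy)<\infty$ such that for every $\epsilon>0$ there is a $\delta>0$ such that for all $a_0,a\in A$ with $d(a,a_0)<\delta$ and all $y\in Y$, $|\eta(a,y)-\eta(a_0,y)|<\epsilon\,h(a_0,y)$. Assume that there are Borel measures $\nu_{\mathcal X}$ on $\mathcal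 X$ and $\nu_{\mathcal Y^i}$ on $\mathcal Y^i$ and bounded continuous non-negative functions $\eta^i:\mathcal X\times\mathcal Y^i\to\mathbb R$ and $\rho^i:\mathcal Y^i\times\mathcal X\to\mathbb R$, $1\le i\le N$, such that, for almost every value of the conditioning variable, $$P(dy^1,\dots,dy^N\mid x)=\prod_{i=1}^N P(dy^i\mid x),\qquad P(dy^i\mid x)=\eta^i(x,y^i)\,\nu_{\mathcal Y^i}(dy^i),\qquad P(dx\mid y^i)=\rho^i(y^i,x)\,\nu_{\mathcal X}(dx)$$ for all $i$, and that all the pairs $(\eta^i,\nu_{\mathcal Y^i})$ and $(\rho^i,\nu_{\mathcal X})$ satisfy Condition C1. A behavioral strategy of agent $i$ is a Markov kernel $\pi^i(du^i\mid y^i)$ from $\mathcal Y^i$ to $\mathcal U^i$; a deterministic strategy is a Borel measurable map $\gamma^i:\mathcal Y^i\to\mathcal U^i$, identified with the behavioral strategy $\delta_{\gamma^i(y^i)}(du^i)$. The expected cost of a profile $\pi=(\pi^1,\dots,\pi^N)$ of behavioral strategies is $$J(\pi)=\int\int c(x,y^1,\dots,y^N,u^1,\dots,u^N)\,\prod_{i=1}^N\pi^i(du^i\mid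 y^i)\,P(dx,dy^1,\dots,dy^N).$$ Then there is a profile $\gamma=(\gamma^1,\dots,\gamma^N)$ of deterministic strategies that is team-optimal among all behavioral profiles: $J(\gamma)=\inf_{\pi}J(\pi)$, the infimum being over all profiles $\pi$ of behavioral strategies. -/

import Mathlib

open MeasureTheory ProbabilityTheory
open scoped NNReal ENNReal BoundedContinuousFunction

namespace StaticTeam

noncomputable section

/-- Condition C1 for a density `η` on `A × Y` with respect to a measure `ν` on `Y`. The function `h`
is the variation control function; it takes finite non-negative values. -/
def ConditionC1 {A Y : Type*} [MetricSpace A] [MeasurableSpace A] [TopologicalSpace Y]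
    [MeasurableSpace Y] (η : A × Y → ℝ) (ν : Measure Y) : Prop :=
  Continuous η ∧
    ∃ h : A × Y → ℝ≥0, Measurable h ∧ (∃ M : ℝ≥0, ∀ z, h z ≤ M) ∧
      (⨆ a, ∫⁻ y, (h (a, y) : ℝ≥0∞) ∂ν) < ∞ ∧
      ∀ ε : ℝ, 0 < ε → ∃ δ : ℝ, 0 < δ ∧ ∀ a₀ a : A, dist a a₀ < δ →
        ∀ y : Y, |η (a, y) - η (a₀, y)| < ε * (h (a₀, y) : ℝ)

/-- A behavioral strategy: a measurable family `π(du | y)` of probability measures on the action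
space, indexed by the observation `y`. -/
structure BehavioralStrategy (Y U : Type*) [MeasurableSpace Y] [MeasurableSpace U] where
  kernel : Kernel Y U
  isMarkov : IsMarkovKernel kernel

/-- A deterministic strategy: a measurable map from observations to actions. -/
structure DeterministicStrategy (Y U : Type*) [MeasurableSpace Y] [MeasurableSpace U] where
  toFun : Y → U
  measurable : Measurable toFun

/-- The behavioral strategy `π(du | y) = δ_{γ(y)}(du)` induced by a deterministic strategy `γ`. -/
def DeterministicStrategy.toBehavioral {Y U : Type*} [MeasurableSpace Y] [MeasurableSpace U]
    (γ : DeterministicStrategy Y U) : BehavioralStrategy Y U where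
  kernel := Kernel.deterministic γ.toFun γ.measurable
  isMarkov := inferInstance

section Team

variable {N : ℕ} {X : Type*} {Y U : Fin N → Type*} [MeasurableSpace X]
  [∀ i, MeasurableSpace (Y i)] [∀ i, MeasurableSpace (U i)]

/-- The expected cost of the strategy profile `π`, where `P` is the joint law of the state and the
observations: given these, the actions are drawn independently, that of agent `i` from
`π i (du | y i)`. -/
def expectedCost (c : X × (∀ i, Y i) × (∀ i, U i) → ℝ) (P : Measure (X × (∀ i, Y i)))
    (π : ∀ i, BehavioralStrategy (Y i) (U i)) : ℝ :=
  ∫ z, ∫ u, c (z.1, z.2, u) ∂(Measure.pi fun i => (π i).kernel (z.2 i)) ∂P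

/-- The profile `π` attains the infimum of the expected cost over all behavioral profiles. -/
def IsTeamOptimal (c : X × (∀ i, Y i) × (∀ i, U i) → ℝ) (P : Measure (X × (∀ i, Y i)))
    (π : ∀ i, BehavioralStrategy (Y i) (U i)) : Prop :=
  ∀ π' : ∀ i, BehavioralStrategy (Y i) (U i), expectedCost c P π ≤ expectedCost c P π'

end Team

end

end StaticTeam

namespace StaticTeam

open Filter Topology unitInterval

/-! ### Domination of the joint law by a product law -/

section AbsoluteContinuity

/-! Conditional independence and continuity of the densities `η i` in the state make `P` absolutely
continuous with respect to the product of its marginals μ and q_i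
(`absolutelyContinuous_prod_pi_map`). With D the Radon–Nikodym derivative, J(π) is the integral of
D·c against μ ⊗ ∏ (q_i ⊗ π_i), so it depends on π only through the joint laws q_i ⊗ π_i.

For fixed q_i these laws form a weakly compact set, since the action spaces are compact. D is only
integrable, but fixing the marginals still makes the cost continuous
(`continuousOn_integral_of_fst_eq`). A minimizer exists and disintegrates into kernels.

Finally, private randomization is driven by independent uniform seeds; the cost is an average over
seeds, so some frozen seed does at least as well (`exists_deterministic_le`). -/

/-- Probability kernels with densities that are continuous in the parameter are absolutely
continuous with respect to their mixture. -/
lemma ae_absolutelyContinuous_comp_of_continuous_density {X Y : Type*} [MetricSpace X]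
    [SecondCountableTopology X] [MeasurableSpace X] [BorelSpace X] [TopologicalSpace Y]
    [MeasurableSpace Y] [BorelSpace Y] {μ : Measure X} {κ : Kernel X Y}
    {ν : Measure Y} {η : X × Y → ℝ} (hη : Continuous η)
    (hκ : ∀ᵐ x ∂μ, κ x = ν.withDensity fun y => ENNReal.ofReal (η (x, y))) :
    ∀ᵐ x ∂μ, κ x ≪ κ ∘ₘ μ := by
  filter_upwards [hκ, Measure.support_mem_ae (μ := μ)] with x hx hsupp
  refine Measure.AbsolutelyContinuous.mk fun B hB hB0 => ?_
  rw [Measure.bind_apply hB κ.aemeasurable, lintegral_eq_zero_iff (κ.measurable_coe hB)] at hB0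
  have hnull : ∀ᵐ x' ∂μ, ∫⁻ y in B, ENNReal.ofReal (η (x', y)) ∂ν = 0 := by
    filter_upwards [hκ, hB0] with x' h1 h2
    rw [← withDensity_apply _ hB, ← h1]
    exact h2
  -- Neighbourhoods of a support point have positive measure, so they meet the conull set where the
  -- integral vanishes.
  have hcl : x ∈ closure {x' | ∫⁻ y in B, ENNReal.ofReal (η (x', y)) ∂ν = 0} := by
    rw [mem_closure_iff_nhds]
    intro V hV
    have hpos := (Measure.mem_support_iff_forall x).1 hsupp V hV
    by_contra hne
    rw [Set.not_nonempty_iff_eq_empty] at hne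
    refine hpos.ne' (measure_mono_null (fun v hv => ?_) hnull)
    intro hv'
    exact (Set.mem_empty_iff_false v).1 (hne ▸ ⟨hv, hv'⟩)
  obtain ⟨u, hu0, hu⟩ := mem_closure_iff_seq_limit.1 hcl
  rw [hx, withDensity_apply _ hB, ← nonpos_iff_eq_zero]
  have hmeas : ∀ a : X, Measurable fun y => ENNReal.ofReal (η (a, y)) := fun a =>
    ENNReal.measurable_ofReal.comp (by fun_prop : Continuous fun y => η (a, y)).measurable
  -- Fatou suffices: only an upper bound at the limit point is needed, so no domination is required.
  calc ∫⁻ y in B, ENNReal.ofReal (η (x, y)) ∂ν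
      = ∫⁻ y in B, liminf (fun n => ENNReal.ofReal (η (u n, y))) atTop ∂ν := by
        refine lintegral_congr fun y => (Tendsto.liminf_eq ?_).symm
        have h : Continuous fun a : X => ENNReal.ofReal (η (a, y)) :=
          ENNReal.continuous_ofReal.comp (by fun_prop)
        exact (h.tendsto x).comp hu
    _ ≤ liminf (fun n => ∫⁻ y in B, ENNReal.ofReal (η (u n, y)) ∂ν) atTop :=
        lintegral_liminf_le fun n => hmeas _
    _ ≤ 0 := by
        have : (fun n => ∫⁻ y in B, ENNReal.ofReal (η (u n, y)) ∂ν) = fun _ => 0 := funext hu0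
        rw [this]; simp

/-- Absolute continuity passes to finite product measures. -/
lemma pi_absolutelyContinuous {n : ℕ} {α : Fin n → Type*} [∀ i, MeasurableSpace (α i)]
    {μ ν : ∀ i, Measure (α i)} [∀ i, SigmaFinite (μ i)] [∀ i, SigmaFinite (ν i)]
    (h : ∀ i, μ i ≪ ν i) : Measure.pi μ ≪ Measure.pi ν := by
  induction n with
  | zero => rw [Subsingleton.elim μ ν]
  | succ n ih =>
    have h1 := (measurePreserving_piFinSuccAbove μ 0).symm
    have h2 := (measurePreserving_piFinSuccAbove ν 0).symm
    rw [← h1.map_eq, ← h2.map_eq]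
    exact ((h 0).prod (ih fun i => h _)).map (MeasurableEquiv.measurable _)

/-- If the observations are independent given the state, and their conditional laws have densities
that are continuous in the state, then the joint law is absolutely continuous with respect to the
product of its marginals. -/
lemma absolutelyContinuous_prod_pi_map {N : ℕ} {X : Type*} {Y : Fin N → Type*}
    [MetricSpace X] [SecondCountableTopology X] [MeasurableSpace X] [BorelSpace X]
    [∀ i, TopologicalSpace (Y i)] [∀ i, PolishSpace (Y i)] [∀ i, Nonempty (Y i)]
    [∀ i, MeasurableSpace (Y i)] [∀ i, BorelSpace (Y i)]
    (P : Measure (X × (∀ i, Y i))) [IsProbabilityMeasure P]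
    (h_indep : ∀ᵐ x ∂(P.map Prod.fst),
      condDistrib (fun z : X × (∀ i, Y i) => z.2) Prod.fst P x =
        Measure.pi fun i => condDistrib (fun z : X × (∀ i, Y i) => z.2 i) Prod.fst P x)
    (νY : ∀ i, Measure (Y i)) (η : ∀ i, X × Y i → ℝ) (hη_cont : ∀ i, Continuous (η i))
    (hη : ∀ i, ∀ᵐ x ∂(P.map Prod.fst),
      condDistrib (fun z : X × (∀ i, Y i) => z.2 i) Prod.fst P x =
        (νY i).withDensity fun y => ENNReal.ofReal (η i (x, y))) :
    P ≪ (P.map Prod.fst).prod (Measure.pi fun i => P.map fun z => z.2 i) := by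
  have hprob : IsProbabilityMeasure (P.map Prod.fst) :=
    Measure.isProbabilityMeasure_map measurable_fst.aemeasurable
  have hprob' : ∀ i, IsProbabilityMeasure (P.map fun z => z.2 i) := fun i =>
    Measure.isProbabilityMeasure_map (by fun_prop)
  have hP : P.map Prod.fst ⊗ₘ condDistrib (fun z : X × (∀ i, Y i) => z.2) Prod.fst P = P := by
    rw [compProd_map_condDistrib (by fun_prop)]
    exact Measure.map_id
  nth_rewrite 1 [← hP]
  -- A product is a composition with a constant kernel, which reduces the claim to almost every
  -- fibre.
  rw [← Measure.compProd_const]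
  refine Measure.AbsolutelyContinuous.compProd_right ?_
  have hac : ∀ᵐ x ∂(P.map Prod.fst), ∀ i,
      condDistrib (fun z : X × (∀ i, Y i) => z.2 i) Prod.fst P x ≪ P.map fun z => z.2 i := by
    rw [ae_all_iff]
    intro i
    -- The mixture of the conditional laws of the i-th observation is its marginal.
    have := ae_absolutelyContinuous_comp_of_continuous_density (hη_cont i) (hη i)
    rwa [condDistrib_comp_map (by fun_prop) (by fun_prop)] at this
  filter_upwards [h_indep, hac] with x h1 h2
  rw [h1, Kernel.const_apply]
  exact pi_absolutelyContinuous h2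

end AbsoluteContinuity

/-! ### Weak topology on laws with a fixed first marginal -/

section Young

/-- On the probability measures on `Y × U` with a given first marginal, the integral of a function
that is integrable in `y` and continuous in `u` depends continuously on the measure. -/
lemma continuousOn_integral_of_fst_eq {Y U : Type*} [TopologicalSpace Y]
    [PolishSpace Y] [MeasurableSpace Y] [BorelSpace Y] [TopologicalSpace U] [PolishSpace U]
    [CompactSpace U] [MeasurableSpace U] [BorelSpace U] (q : Measure Y) [IsProbabilityMeasure q]
    {F : Y → C(U, ℝ)} (hF : Integrable F q)
    (hFm : ∀ R : Measure (Y × U), AEStronglyMeasurable (fun p : Y × U => F p.1 p.2) R) :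
    ContinuousOn (fun R : ProbabilityMeasure (Y × U) => ∫ p, F p.1 p.2 ∂(R : Measure (Y × U)))
      {R | (R : Measure (Y × U)).fst = q} := by
  let := TopologicalSpace.upgradeIsCompletelyMetrizable Y
  refine continuousOn_of_uniform_approx_of_continuousOn fun V hV => ?_
  obtain ⟨ε, hε, hεV⟩ := Metric.mem_uniformity_dist.1 hV
  -- Bounded continuous maps are dense in L¹(q; C(U)). The error of replacing `F` by `g` is at most
  -- ∫ ‖F - g‖ dq, uniformly in `R` because only its first marginal enters.
  obtain ⟨g, hg, hgi⟩ := hF.exists_boundedContinuous_integral_sub_le (half_pos hε)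
  let G : (Y × U) →ᵇ ℝ := BoundedContinuousFunction.ofNormedAddCommGroup
    (fun p => g p.1 p.2) (by fun_prop) ‖g‖
    fun p => ((g p.1).norm_coe_le_norm p.2).trans (g.norm_coe_le_norm p.1)
  refine ⟨fun R => ∫ p, G p ∂(R : Measure (Y × U)),
    (ProbabilityMeasure.continuous_integral_boundedContinuousFunction G).continuousOn,
    fun R hR => hεV ?_⟩
  have hR : (R : Measure (Y × U)).fst = q := hR
  have hdom : ∀ {k : Y → C(U, ℝ)}, Integrable k q →
      Integrable (fun p : Y × U => ‖k p.1‖) (R : Measure (Y × U)) := fun {k} hk => by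
    rw [← hR] at hk
    exact (hk.norm.comp_measurable measurable_fst)
  have hFi : Integrable (fun p : Y × U => F p.1 p.2) (R : Measure (Y × U)) :=
    (hdom hF).mono' (hFm _) (ae_of_all _ fun p => (F p.1).norm_coe_le_norm p.2)
  have hGi : Integrable (fun p : Y × U => G p) (R : Measure (Y × U)) := G.integrable _
  have hFg : Integrable (fun y => F y - g y) q := hF.sub hgi
  have hpt : ∀ p : Y × U, |F p.1 p.2 - G p| ≤ ‖F p.1 - g p.1‖ := fun p => by
    have h := (F p.1 - g p.1).norm_coe_le_norm p.2
    rwa [ContinuousMap.sub_apply, Real.norm_eq_abs] at h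
  have hFgR : Integrable (fun p : Y × U => ‖F p.1 - g p.1‖) (R : Measure (Y × U)) :=
    hdom (k := fun y => F y - g y) hFg
  have hmap : ∫ p, ‖F p.1 - g p.1‖ ∂(R : Measure (Y × U)) = ∫ y, ‖F y - g y‖ ∂q := by
    have hm := hFg.norm.aestronglyMeasurable
    rw [← hR, Measure.fst] at hm ⊢
    exact (integral_map measurable_fst.aemeasurable hm).symm
  rw [Real.dist_eq, ← integral_sub hFi hGi]
  calc |∫ p, F p.1 p.2 - G p ∂(R : Measure (Y × U))|
      ≤ ∫ p, |F p.1 p.2 - G p| ∂(R : Measure (Y × U)) := abs_integral_le_integral_abs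
    _ ≤ ∫ p, ‖F p.1 - g p.1‖ ∂(R : Measure (Y × U)) :=
        integral_mono (hFi.sub hGi).abs hFgR hpt
    _ = ∫ y, ‖F y - g y‖ ∂q := hmap
    _ ≤ ε / 2 := hg
    _ < ε := half_lt_self hε

/-- The probability measures on `Y × U` with a given first marginal form a compact set. -/
lemma isCompact_setOf_fst_eq {Y U : Type*} [TopologicalSpace Y] [PolishSpace Y]
    [MeasurableSpace Y] [BorelSpace Y] [TopologicalSpace U] [PolishSpace U] [CompactSpace U]
    [MeasurableSpace U] [BorelSpace U] (q : Measure Y) [IsProbabilityMeasure q] :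
    IsCompact {R : ProbabilityMeasure (Y × U) | (R : Measure (Y × U)).fst = q} := by
  have hclosed : IsClosed {R : ProbabilityMeasure (Y × U) | (R : Measure (Y × U)).fst = q} := by
    let q₀ : ProbabilityMeasure Y := ⟨q, inferInstance⟩
    have h := (isClosed_singleton (x := q₀)).preimage
      (ProbabilityMeasure.continuous_map (continuous_fst (X := Y) (Y := U)))
    convert h using 1
    ext R
    exact ProbabilityMeasure.toMeasure_injective.eq_iff (a := R.map _) (b := q₀)
  rw [← hclosed.closure_eq]
  -- Prokhorov: the first marginals reduce to the tight measure `q`, the second live on a compact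
  -- space.
  refine isCompact_closure_of_isTightMeasureSet (IsTightMeasureSet.prodMk ?_ .of_compactSpace)
  refine IsTightMeasureSet.subset (isTightMeasureSet_singleton (μ := q)) ?_
  rintro _ ⟨_, ⟨R, hR, rfl⟩, rfl⟩
  exact hR

end Young

/-! ### Kernels as functions of independent seeds -/

section Randomization

/-- The product of the product measures is the product measure of the products. -/
lemma map_prod_pi_eq_pi_prod {ι : Type*} [Fintype ι] {α β : ι → Type*}
    [∀ i, MeasurableSpace (α i)] [∀ i, MeasurableSpace (β i)] (μ : ∀ i, Measure (α i))
    (ν : ∀ i, Measure (β i)) [∀ i, IsProbabilityMeasure (μ i)] [∀ i, IsProbabilityMeasure (ν i)] :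
    ((Measure.pi μ).prod (Measure.pi ν)).map (fun p i => (p.1 i, p.2 i)) =
      Measure.pi fun i => (μ i).prod (ν i) := by
  refine (Measure.pi_eq_generateFrom (fun i => generateFrom_prod) (fun i => isPiSystem_prod)
    (fun i => (μ i).toFiniteSpanningSetsIn.prod (ν i).toFiniteSpanningSetsIn) ?_).symm
  intro s hs
  choose a ha b hb hab using hs
  have hpre : (fun (p : (∀ i, α i) × (∀ i, β i)) i => (p.1 i, p.2 i)) ⁻¹' Set.univ.pi s =
      Set.univ.pi a ×ˢ Set.univ.pi b := by
    ext p
    simp only [Set.mem_preimage, Set.mem_univ_pi, ← hab, Set.mem_prod, ← forall_and]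
  rw [Measure.map_apply (by fun_prop) (.univ_pi fun i => hab i ▸ (ha i).prod (hb i)), hpre,
    Measure.prod_prod, Measure.pi_pi, Measure.pi_pi, ← Finset.prod_mul_distrib]
  simp only [← hab, Measure.prod_prod]

lemma compProd_eq_map_of_map_eq {Y U T : Type*} [MeasurableSpace Y] [MeasurableSpace U]
    [MeasurableSpace T] (q : Measure Y) [SFinite q] (κ : Kernel Y U) [IsSFiniteKernel κ]
    (τ : Measure T) [SFinite τ] {g : Y → T → U} (hg : Measurable (Function.uncurry g))
    (h : ∀ y, τ.map (g y) = κ y) :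
    q ⊗ₘ κ = (q.prod τ).map fun p => (p.1, g p.1 p.2) := by
  have hg' : Measurable fun p : Y × T => (p.1, g p.1 p.2) := measurable_fst.prodMk hg
  ext s hs
  rw [Measure.compProd_apply hs, Measure.map_apply hg' hs, Measure.prod_apply (hg' hs)]
  refine lintegral_congr fun y => ?_
  have hgy : Measurable (g y) := hg.comp measurable_prodMk_left
  rw [← h, Measure.map_apply hgy (measurable_prodMk_left hs)]
  rfl

/-- Regrouping of a state and pairs of observations and actions. -/
def regroup {ι X : Type*} {Y U : ι → Type*} (p : X × (∀ i, Y i × U i)) :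
    (X × (∀ i, Y i)) × (∀ i, U i) :=
  ((p.1, fun i => (p.2 i).1), fun i => (p.2 i).2)

/-- Independence holds across the pairs (observation, action), while the cost and D want all
observations together. Seeds make both groupings images of one product measure, so no product kernel
is needed. -/
lemma map_regroup_eq {ι X : Type*} [Fintype ι] {Y U : ι → Type*} [MeasurableSpace X]
    [∀ i, MeasurableSpace (Y i)] [∀ i, MeasurableSpace (U i)] (μ : Measure X)
    [IsProbabilityMeasure μ] (q : ∀ i, Measure (Y i)) [∀ i, IsProbabilityMeasure (q i)]
    (κ : ∀ i, Kernel (Y i) (U i)) [∀ i, IsMarkovKernel (κ i)] {g : ∀ i, Y i → I → U i}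
    (hg : ∀ i, Measurable (Function.uncurry (g i)))
    (h : ∀ i y, (volume : Measure I).map (g i y) = κ i y) :
    (μ.prod (Measure.pi fun i => q i ⊗ₘ κ i)).map regroup =
      ((μ.prod (Measure.pi q)).prod (Measure.pi fun _ => (volume : Measure I))).map
        fun p => (p.1, fun i => g i (p.1.2 i) (p.2 i)) := by
  have hg' : ∀ i, Measurable fun p : Y i × I => (p.1, g i p.1 p.2) := fun i =>
    measurable_fst.prodMk (hg i)
  have hpi : Measure.pi (fun i => q i ⊗ₘ κ i) =
      ((Measure.pi q).prod (Measure.pi fun _ => (volume : Measure I))).map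
        fun p i => (p.1 i, g i (p.1 i) (p.2 i)) := by
    have hprob : ∀ i, IsProbabilityMeasure
        (((q i).prod (volume : Measure I)).map fun p => (p.1, g i p.1 p.2)) := fun i =>
      Measure.isProbabilityMeasure_map (hg' i).aemeasurable
    simp_rw [fun i => compProd_eq_map_of_map_eq (q i) (κ i) volume (hg i) (h i)]
    rw [← Measure.pi_map_pi fun i => (hg' i).aemeasurable, ← map_prod_pi_eq_pi_prod,
      Measure.map_map (by fun_prop) (by fun_prop)]
    rfl
  have hm : Measurable fun p : (∀ i, Y i) × (ι → I) =>
      fun i => (p.1 i, g i (p.1 i) (p.2 i)) := by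
    refine measurable_pi_lambda _ fun i => ?_
    exact (hg' i).comp (by fun_prop : Measurable fun p : (∀ i, Y i) × (ι → I) => (p.1 i, p.2 i))
  have hm' : Measurable fun p : (X × (∀ i, Y i)) × (ι → I) =>
      (p.1, fun i => g i (p.1.2 i) (p.2 i)) := by
    refine measurable_fst.prodMk (measurable_pi_lambda _ fun i => ?_)
    exact (hg i).comp
      (by fun_prop : Measurable fun p : (X × (∀ i, Y i)) × (ι → I) => (p.1.2 i, p.2 i))
  have hr : Measurable (regroup : X × (∀ i, Y i × U i) → _) := by unfold regroup; fun_prop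
  have hid : μ.prod (Measure.pi fun i => q i ⊗ₘ κ i) =
      (μ.prod ((Measure.pi q).prod (Measure.pi fun _ => (volume : Measure I)))).map
        (Prod.map id fun p i => (p.1 i, g i (p.1 i) (p.2 i))) := by
    rw [hpi, ← Measure.map_prod_map _ _ measurable_id hm, Measure.map_id]
  rw [hid, Measure.map_map hr (measurable_id.prodMap hm),
    ← (measurePreserving_prodAssoc μ (Measure.pi q)
      (Measure.pi fun _ => (volume : Measure I))).map_eq,
    Measure.map_map (hr.comp (measurable_id.prodMap hm)) (MeasurableEquiv.measurable _)]
  rfl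

end Randomization

/-! ### Seed and change-of-measure formulas for the cost -/

section Cost

variable {N : ℕ} {X : Type*} {Y U : Fin N → Type*} [MeasurableSpace X]
  [∀ i, MeasurableSpace (Y i)] [∀ i, MeasurableSpace (U i)]

lemma exists_measurable_map_eq [∀ i, StandardBorelSpace (U i)] [∀ i, Nonempty (U i)]
    (π : ∀ i, BehavioralStrategy (Y i) (U i)) :
    ∃ g : ∀ i, Y i → I → U i, (∀ i, Measurable (Function.uncurry (g i))) ∧
      ∀ i y, (volume : Measure I).map (g i y) = (π i).kernel y := by
  have h : ∀ i, ∃ g : Y i → I → U i, Measurable (Function.uncurry g) ∧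
      ∀ y, (volume : Measure I).map (g y) = (π i).kernel y := fun i => by
    have := (π i).isMarkov
    exact Kernel.exists_measurable_map_eq_unitInterval (π i).kernel
  choose g hg hgm using h
  exact ⟨g, hg, hgm⟩

variable {c : X × (∀ i, Y i) × (∀ i, U i) → ℝ} {P : Measure (X × (∀ i, Y i))}

/-- The expected cost in terms of independent uniform randomization devices. -/
lemma expectedCost_eq_integral_randomized (hc : Measurable c)
    {π : ∀ i, BehavioralStrategy (Y i) (U i)} {g : ∀ i, Y i → I → U i}
    (hg : ∀ i, Measurable (Function.uncurry (g i)))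
    (h : ∀ i y, (volume : Measure I).map (g i y) = (π i).kernel y) :
    expectedCost c P π =
      ∫ z, ∫ t, c (z.1, z.2, fun i => g i (z.2 i) (t i))
        ∂(Measure.pi fun _ : Fin N => (volume : Measure I)) ∂P := by
  unfold expectedCost
  congr 1 with z
  have hm : ∀ i, Measurable (g i (z.2 i)) := fun i => (hg i).comp measurable_prodMk_left
  have hprob : ∀ i, IsProbabilityMeasure ((volume : Measure I).map (g i (z.2 i))) := fun i =>
    Measure.isProbabilityMeasure_map (hm i).aemeasurable
  simp_rw [← h]
  rw [← Measure.pi_map_pi fun i => (hm i).aemeasurable, integral_map]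
  · exact (measurable_pi_lambda _ fun i => (hm i).comp (measurable_pi_apply i)).aemeasurable
  · exact (hc.comp (by fun_prop)).aestronglyMeasurable

lemma expectedCost_toBehavioral (hc : Measurable c)
    (γ : ∀ i, DeterministicStrategy (Y i) (U i)) :
    expectedCost c P (fun i => (γ i).toBehavioral) =
      ∫ z, c (z.1, z.2, fun i => (γ i).toFun (z.2 i)) ∂P := by
  -- A deterministic strategy ignores its seed.
  rw [expectedCost_eq_integral_randomized hc (g := fun i y _ => (γ i).toFun y)]
  · simp
  · exact fun i => (γ i).measurable.comp measurable_fst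
  · intro i y
    simp [DeterministicStrategy.toBehavioral, Kernel.deterministic_apply]

/-- Every behavioral profile is weakly dominated by a deterministic profile. -/
lemma exists_deterministic_le [∀ i, StandardBorelSpace (U i)] [∀ i, Nonempty (U i)]
    [IsProbabilityMeasure P] (hc : Measurable c) {M : ℝ} (hM : ∀ z, |c z| ≤ M)
    (π : ∀ i, BehavioralStrategy (Y i) (U i)) :
    ∃ γ : ∀ i, DeterministicStrategy (Y i) (U i),
      expectedCost c P (fun i => (γ i).toBehavioral) ≤ expectedCost c P π := by
  obtain ⟨g, hg, h⟩ := exists_measurable_map_eq π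
  have hm : Measurable fun p : (X × (∀ i, Y i)) × (Fin N → I) =>
      c (p.1.1, p.1.2, fun i => g i (p.1.2 i) (p.2 i)) := by
    refine hc.comp (.prodMk (by fun_prop) (.prodMk (by fun_prop) ?_))
    refine measurable_pi_lambda _ fun i => ?_
    exact (hg i).comp
      (by fun_prop : Measurable fun p : (X × (∀ i, Y i)) × (Fin N → I) => (p.1.2 i, p.2 i))
  have hint : Integrable (fun p : (X × (∀ i, Y i)) × (Fin N → I) =>
      c (p.1.1, p.1.2, fun i => g i (p.1.2 i) (p.2 i)))
      (P.prod (Measure.pi fun _ => (volume : Measure I))) :=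
    Integrable.of_bound hm.aestronglyMeasurable M (ae_of_all _ fun p => hM _)
  -- Some seed profile costs no more than the average; freezing it leaves each action a function of
  -- its agent's own observation.
  obtain ⟨t, ht⟩ := exists_le_integral hint.integral_prod_right
  refine ⟨fun i => ⟨fun y => g i y (t i), (hg i).comp measurable_prodMk_right⟩, ?_⟩
  rw [expectedCost_toBehavioral hc, expectedCost_eq_integral_randomized hc hg h,
    integral_integral_swap hint]
  exact ht

/-- The expected cost after a change of measure from the law `P` of the state and the observations
to a law `μ.prod (Measure.pi q)` under which these are independent. -/
lemma expectedCost_eq_integral_regroup [∀ i, StandardBorelSpace (U i)] [∀ i, Nonempty (U i)]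
    [IsProbabilityMeasure P] (hc : Measurable c) {M : ℝ} (hM : ∀ z, |c z| ≤ M)
    (μ : Measure X) [IsProbabilityMeasure μ] (q : ∀ i, Measure (Y i))
    [∀ i, IsProbabilityMeasure (q i)] (hP : P ≪ μ.prod (Measure.pi q))
    (π : ∀ i, BehavioralStrategy (Y i) (U i)) :
    expectedCost c P π =
      ∫ p, (P.rnDeriv (μ.prod (Measure.pi q)) p.1).toReal * c (p.1.1, p.1.2, p.2)
        ∂((μ.prod (Measure.pi fun i => q i ⊗ₘ (π i).kernel)).map regroup) := by
  obtain ⟨g, hg, h⟩ := exists_measurable_map_eq π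
  have : ∀ i, IsMarkovKernel (π i).kernel := fun i => (π i).isMarkov
  have hgm : Measurable fun p : (X × (∀ i, Y i)) × (Fin N → I) =>
      fun i => g i (p.1.2 i) (p.2 i) := by
    refine measurable_pi_lambda _ fun i => ?_
    exact (hg i).comp
      (by fun_prop : Measurable fun p : (X × (∀ i, Y i)) × (Fin N → I) => (p.1.2 i, p.2 i))
  have hD : Measurable fun z => (P.rnDeriv (μ.prod (Measure.pi q)) z).toReal :=
    (Measure.measurable_rnDeriv _ _).ennreal_toReal
  have hint : Integrable (fun p : (X × (∀ i, Y i)) × (Fin N → I) =>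
      (P.rnDeriv (μ.prod (Measure.pi q)) p.1).toReal *
        c (p.1.1, p.1.2, fun i => g i (p.1.2 i) (p.2 i)))
      ((μ.prod (Measure.pi q)).prod (Measure.pi fun _ => (volume : Measure I))) := by
    refine Integrable.mul_bdd (c := M) ?_ ?_ (ae_of_all _ fun p => hM _)
    · exact Measure.integrable_toReal_rnDeriv.comp_fst _
    · exact (hc.comp (by fun_prop)).aestronglyMeasurable
  rw [map_regroup_eq μ q _ hg h, integral_map (by fun_prop), integral_prod _ hint,
    expectedCost_eq_integral_randomized hc hg h, ← integral_rnDeriv_smul hP]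
  · simp_rw [integral_const_mul, smul_eq_mul]
  · exact ((hD.comp measurable_fst).mul (hc.comp (by fun_prop))).aestronglyMeasurable

end Cost

/-! ### Existence of a minimizer -/

section Existence

variable {N : ℕ} {X : Type*} {Y U : Fin N → Type*} [TopologicalSpace X] [PolishSpace X]
  [MeasurableSpace X] [BorelSpace X] [∀ i, TopologicalSpace (Y i)] [∀ i, PolishSpace (Y i)]
  [∀ i, MeasurableSpace (Y i)] [∀ i, BorelSpace (Y i)] [∀ i, TopologicalSpace (U i)]
  [∀ i, PolishSpace (U i)] [∀ i, CompactSpace (U i)] [∀ i, MeasurableSpace (U i)]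
  [∀ i, BorelSpace (U i)] {c : X × (∀ i, Y i) × (∀ i, U i) → ℝ}

/-- The expected cost, after the change of measure, depends continuously on the joint laws of the
observations and the actions of the agents. -/
lemma continuousOn_integral_regroup (hc : Continuous c) {M : ℝ} (hM : ∀ z, |c z| ≤ M)
    (μ : Measure X) [IsProbabilityMeasure μ] (q : ∀ i, Measure (Y i))
    [∀ i, IsProbabilityMeasure (q i)] {D : X × (∀ i, Y i) → ℝ} (hDm : Measurable D)
    (hD : Integrable D (μ.prod (Measure.pi q))) :
    ContinuousOn (fun m : ∀ i, ProbabilityMeasure (Y i × U i) =>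
        ∫ p, D p.1 * c (p.1.1, p.1.2, p.2)
          ∂((μ.prod (Measure.pi fun i => (m i : Measure (Y i × U i)))).map regroup))
      (Set.univ.pi fun i => {R | (R : Measure (Y i × U i)).fst = q i}) := by
  have hcont : Continuous (regroup : X × (∀ i, Y i × U i) → _) := by unfold regroup; fun_prop
  let c' : C(X × (∀ i, Y i), C(∀ i, U i, ℝ)) :=
    ContinuousMap.curry ⟨fun p => c (p.1.1, p.1.2, p.2), by fun_prop⟩
  let F : X × (∀ i, Y i) → C(∀ i, U i, ℝ) := fun z => D z • c' z
  have hF : Integrable F (μ.prod (Measure.pi q)) := by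
    -- `M` may be negative if some `U i` is empty, hence `|M|`.
    refine hD.smul_bdd |M| c'.continuous.aestronglyMeasurable (ae_of_all _ fun z => ?_)
    exact (ContinuousMap.norm_le _ (abs_nonneg M)).2 fun u => (hM _).trans (le_abs_self M)
  have hcomp := continuousOn_integral_of_fst_eq (U := ∀ i, U i) (μ.prod (Measure.pi q)) hF
    fun R => by
      refine Measurable.aestronglyMeasurable ?_
      exact (hDm.comp measurable_fst).mul
        (by fun_prop : Continuous fun p : (X × (∀ i, Y i)) × (∀ i, U i) =>
          c (p.1.1, p.1.2, p.2)).measurable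
  let μ₀ : ProbabilityMeasure X := ⟨μ, inferInstance⟩
  -- Weak convergence of the factors passes to products and to continuous images.
  have hΨ : Continuous fun m : ∀ i, ProbabilityMeasure (Y i × U i) =>
      (μ₀.prod (ProbabilityMeasure.pi m)).map hcont.measurable.aemeasurable :=
    (ProbabilityMeasure.continuous_map hcont).comp (ProbabilityMeasure.continuous_prod.comp
      (continuous_const.prodMk ProbabilityMeasure.continuous_pi))
  refine hcomp.comp hΨ.continuousOn fun m hm => ?_
  have hq : q = fun i => (m i : Measure (Y i × U i)).map Prod.fst :=
    funext fun i => (hm i trivial).symm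
  change ((μ.prod (Measure.pi fun i => (m i : Measure (Y i × U i)))).map regroup).fst = _
  have hprob : ∀ i, IsProbabilityMeasure ((m i : Measure (Y i × U i)).map Prod.fst) := fun i =>
    Measure.isProbabilityMeasure_map measurable_fst.aemeasurable
  rw [hq, ← Measure.pi_map_pi fun i => measurable_fst.aemeasurable]
  nth_rewrite 2 [← Measure.map_id (μ := μ)]
  rw [Measure.map_prod_map _ _ measurable_id (by fun_prop), Measure.fst,
    Measure.map_map measurable_fst hcont.measurable]
  rfl

/-- If the joint law of the state and the observations is absolutely continuous with respect to a
product measure, then there is an optimal behavioral profile. -/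
lemma exists_isTeamOptimal [∀ i, Nonempty (U i)] (hc : Continuous c) {M : ℝ} (hM : ∀ z, |c z| ≤ M)
    {P : Measure (X × (∀ i, Y i))} [IsProbabilityMeasure P]
    (μ : Measure X) [IsProbabilityMeasure μ] (q : ∀ i, Measure (Y i))
    [∀ i, IsProbabilityMeasure (q i)] (hP : P ≪ μ.prod (Measure.pi q)) :
    ∃ π : ∀ i, BehavioralStrategy (Y i) (U i), IsTeamOptimal c P π := by
  have hcost := fun π => expectedCost_eq_integral_regroup hc.measurable hM μ q hP π
  have hcompact : IsCompact (Set.univ.pi fun i =>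
      {R : ProbabilityMeasure (Y i × U i) | (R : Measure (Y i × U i)).fst = q i}) :=
    isCompact_univ_pi fun i => isCompact_setOf_fst_eq (q i)
  have hlaw : ∀ π : ∀ i, BehavioralStrategy (Y i) (U i),
      ∃ m ∈ (Set.univ.pi fun i =>
        {R : ProbabilityMeasure (Y i × U i) | (R : Measure (Y i × U i)).fst = q i}),
        ∀ i, (m i : Measure (Y i × U i)) = q i ⊗ₘ (π i).kernel := fun π => by
    have : ∀ i, IsMarkovKernel (π i).kernel := fun i => (π i).isMarkov
    exact ⟨fun i => ⟨q i ⊗ₘ (π i).kernel, inferInstance⟩,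
      fun i _ => Measure.fst_compProd _ _, fun i => rfl⟩
  have hne : (Set.univ.pi fun i =>
      {R : ProbabilityMeasure (Y i × U i) | (R : Measure (Y i × U i)).fst = q i}).Nonempty := by
    obtain ⟨m, hm, -⟩ := hlaw fun i =>
      ⟨Kernel.const _ (Measure.dirac (Classical.arbitrary (U i))), inferInstance⟩
    exact ⟨m, hm⟩
  obtain ⟨m, hm, hmin⟩ := hcompact.exists_isMinOn hne
    (continuousOn_integral_regroup hc hM μ q (Measure.measurable_rnDeriv P _).ennreal_toReal
      Measure.integrable_toReal_rnDeriv)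
  -- Disintegration over the prescribed marginal `q i` turns the minimizing laws back into
  -- strategies.
  have hdis : ∀ i, q i ⊗ₘ (m i : Measure (Y i × U i)).condKernel = m i := fun i => by
    have h := (m i : Measure (Y i × U i)).disintegrate (m i : Measure (Y i × U i)).condKernel
    rwa [show (m i : Measure (Y i × U i)).fst = q i from hm i trivial] at h
  refine ⟨fun i => ⟨(m i : Measure (Y i × U i)).condKernel, inferInstance⟩, fun π => ?_⟩
  obtain ⟨m', hm', hmπ⟩ := hlaw π
  have := isMinOn_iff.1 hmin m' hm'
  rw [hcost, hcost]
  simp_rw [hdis, ← hmπ]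
  exact this

end Existence

end StaticTeam

theorem mainTheorem3 {N : ℕ} {X : Type*} {Y U : Fin N → Type*}
    -- the state space: a sigma-compact complete separable metric space
    [MetricSpace X] [CompleteSpace X] [SecondCountableTopology X] [SigmaCompactSpace X]
    [Nonempty X] [MeasurableSpace X] [BorelSpace X]
    -- the observation spaces: sigma-compact complete separable metric spaces
    [∀ i, MetricSpace (Y i)] [∀ i, CompleteSpace (Y i)] [∀ i, SecondCountableTopology (Y i)]
    [∀ i, SigmaCompactSpace (Y i)] [∀ i, Nonempty (Y i)]
    [∀ i, MeasurableSpace (Y i)] [∀ i, BorelSpace (Y i)]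
    -- the action spaces: non-empty compact Polish spaces
    [∀ i, TopologicalSpace (U i)] [∀ i, PolishSpace (U i)] [∀ i, CompactSpace (U i)]
    [∀ i, Nonempty (U i)] [∀ i, MeasurableSpace (U i)] [∀ i, BorelSpace (U i)]
    -- the cost function
    (c : X × (∀ i, Y i) × (∀ i, U i) → ℝ) (hc_cont : Continuous c) (hc_nonneg : ∀ z, 0 ≤ c z)
    (hc_bdd : ∃ M : ℝ, ∀ z, c z ≤ M)
    -- the joint law of the state and the observations
    (P : Measure (X × (∀ i, Y i))) [IsProbabilityMeasure P]
    -- given the state, the observations are independent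
    (h_indep : ∀ᵐ x ∂(P.map Prod.fst),
      condDistrib (fun z : X × (∀ i, Y i) => z.2) Prod.fst P x =
        Measure.pi fun i => condDistrib (fun z : X × (∀ i, Y i) => z.2 i) Prod.fst P x)
    -- reference measures and bounded continuous densities
    (νX : Measure X) (νY : ∀ i, Measure (Y i))
    (η : ∀ i, (X × Y i) →ᵇ ℝ) (ρ : ∀ i, (Y i × X) →ᵇ ℝ)
    (hη_nonneg : ∀ i z, 0 ≤ η i z) (hρ_nonneg : ∀ i z, 0 ≤ ρ i z)
    (hη : ∀ i, ∀ᵐ x ∂(P.map Prod.fst),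
      condDistrib (fun z : X × (∀ i, Y i) => z.2 i) Prod.fst P x =
        (νY i).withDensity fun y => ENNReal.ofReal (η i (x, y)))
    (hρ : ∀ i, ∀ᵐ y ∂(P.map fun z => z.2 i),
      condDistrib Prod.fst (fun z : X × (∀ i, Y i) => z.2 i) P y =
        νX.withDensity fun x => ENNReal.ofReal (ρ i (y, x)))
    (hη_C1 : ∀ i, StaticTeam.ConditionC1 (η i) (νY i))
    (hρ_C1 : ∀ i, StaticTeam.ConditionC1 (ρ i) νX) :
    ∃ γ : ∀ i, StaticTeam.DeterministicStrategy (Y i) (U i),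
      StaticTeam.IsTeamOptimal c P fun i => (γ i).toBehavioral := by
  obtain ⟨M, hM⟩ := hc_bdd
  have hM' : ∀ z, |c z| ≤ M := fun z => (abs_of_nonneg (hc_nonneg z)).trans_le (hM z)
  have : IsProbabilityMeasure (P.map Prod.fst) :=
    Measure.isProbabilityMeasure_map measurable_fst.aemeasurable
  have : ∀ i, IsProbabilityMeasure (P.map fun z => z.2 i) := fun i =>
    Measure.isProbabilityMeasure_map (by fun_prop)
  have hP := StaticTeam.absolutelyContinuous_prod_pi_map P h_indep νY (fun i => η i)
    (fun i => (η i).continuous) hη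
  obtain ⟨π, hπ⟩ := StaticTeam.exists_isTeamOptimal hc_cont hM' _ _ hP
  obtain ⟨γ, hγ⟩ := StaticTeam.exists_deterministic_le (P := P) hc_cont.measurable hM' π
  exact ⟨γ, fun π' => hγ.trans (hπ π')⟩
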